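/- Let $\mathbb F_q$ be a finite field, let $F_1\subsetneq F_0\subseteq\mathbb F_q^n$ be linear codes of dimensions $f_1<f_0$, and let $G_E\in\mathbb F_q^{e\times n}$ be a matrix (not necessarily of full rank) with row space $E$ such that $F_0\cap E=\{0\}$. Let $G_{F_1}$ be a generator matrix of $F_1$ and let $G_{F_0/F_1}$ be a generator matrix of a complement of $F_1$ in $F_0$. The extended CSS code $\mathrm{ECSS}(F_0,F_1,G_E)$ encodes a secret of $m=f_0-f_1$ qudits of dimension $q$ into $n$ original qudits and $e$ extension qudits by the linear isometry $$|\underline s\rangle\ \mapsto\ q^{-(f_1+e)/2}\sum_{\underline r_1\in\mathbb F_q^{f_1},\ \underline r_2\in\mathbb F_q^{e}}\big|\,G_{F_0/F_1}^T\underline s+G_{F_1}^T\underline r_1+G_E^T\underline r_2\big\rangle\,|\underline r_2\rangle ,\qquad \underline s\in\mathbb F_q^{m}.$$ For a set $J$ of original qudits, the secret can be recovered from $J$ and all the extension qudits if there is a quantum channel $\mathcal R$, acting on those qudits only, which maps the reduced state, on those qudits, of the encoding of every secret state $\rho$ back to $\rho$. For codes $C_1\subsetneq C_0$ let $\mathrm{wt}(C_0\setminus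 C_1)$ be the minimum Hamming weight of a vector in $C_0\setminus C_1$, and let $C^\perp$ be the Euclidean dual of $C$. Then $F_0\setminus F_1$ and $(F_1+E)^\perp\setminus(F_0+E)^\perp$ are nonempty and, for every integer $\tau\ge 0$, the secret can be recovered from every set $J$ of exactly $\tau$ of the $n$ original qudits together with all $e$ extension qudits if and only if $$\tau\ \ge\ n-\min\{\mathrm{wt}(F_0\setminus F_1),\ \mathrm{wt}((F_1+E)^\perp\setminus(F_0+E)^\perp)\}+1 .$$ -/

import Mathlib

open Matrix
open scoped ComplexOrder

/-! ### Linear codes -/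

/-- The row space of a matrix. -/
def rowSpace {F κ ι : Type*} [Field F] (G : Matrix κ ι F) : Submodule F (ι → F) :=
  Submodule.span F (Set.range G.row)

/-- `G` is a generator matrix of the linear code `C`: its rows form a basis of `C`. -/
def IsGeneratorMatrix {F κ ι : Type*} [Field F] (G : Matrix κ ι F)
    (C : Submodule F (ι → F)) : Prop :=
  LinearIndependent F G.row ∧ rowSpace G = C

/-- `G` is a generator matrix `G_{C₀/C₁}`, that is, a generator matrix of a complement of
`C₁` in `C₀`. -/
def IsQuotientGeneratorMatrix {F κ ι : Type*} [Field F] (G : Matrix κ ι F)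
    (C₀ C₁ : Submodule F (ι → F)) : Prop :=
  ∃ D : Submodule F (ι → F), D ⊓ C₁ = ⊥ ∧ D ⊔ C₁ = C₀ ∧ IsGeneratorMatrix G D

/-- The (Euclidean) dual code `C^⊥`. -/
def dualCode {F ι : Type*} [Field F] [Fintype ι] (C : Submodule F (ι → F)) :
    Submodule F (ι → F) where
  carrier := {x | ∀ c ∈ C, c ⬝ᵥ x = 0}
  add_mem' := by
    intro x y hx hy c hc
    rw [dotProduct_add, hx c hc, hy c hc, add_zero]
  zero_mem' := by
    intro c _
    exact dotProduct_zero c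
  smul_mem' := by
    intro a x hx c hc
    rw [dotProduct_smul, hx c hc, smul_zero]

/-- The set difference `C₀ ∖ C₁` of two codes. -/
def codeDiff {F ι : Type*} [Field F] (C₀ C₁ : Submodule F (ι → F)) : Set (ι → F) :=
  {c | c ∈ C₀ ∧ c ∉ C₁}

/-- `wt(S)`: the minimum Hamming weight of the vectors in `S` (a genuine minimum when `S` is
nonempty). -/
noncomputable def minWeight {F ι : Type*} [Field F] [DecidableEq F] [Fintype ι]
    (S : Set (ι → F)) : ℕ :=
  sInf (hammingNorm '' S)

/-! ### Quantum states, channels and partial traces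

A register of qudits labelled by `ι`, each with standard basis `{|a⟩ : a ∈ F}`, has the standard
basis `{|x⟩ : x ∈ F^ι}`; its operators are the complex matrices indexed by `ι → F`. -/

/-- Density matrices. -/
def IsDensityMatrix {α : Type*} [Fintype α] (ρ : Matrix α α ℂ) : Prop :=
  ρ.PosSemidef ∧ ρ.trace = 1

/-- Quantum channels (completely positive trace-preserving maps), given by Kraus operators. -/
def IsQuantumChannel {α β : Type*} [Fintype α] [DecidableEq α] [Fintype β]
    (Φ : Matrix α α ℂ → Matrix β β ℂ) : Prop :=
  ∃ (r : ℕ) (K : Fin r → Matrix β α ℂ),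
    ∑ i, (K i)ᴴ * K i = 1 ∧ ∀ ρ, Φ ρ = ∑ i, K i * ρ * (K i)ᴴ

/-- The reduced state on the qudits in `A`: the partial trace over all qudits outside `A`. -/
def reducedState {F ι : Type*} [Fintype F] [Fintype ι] [DecidableEq ι]
    (A : Finset ι) (σ : Matrix (ι → F) (ι → F) ℂ) :
    Matrix ({i // i ∈ A} → F) ({i // i ∈ A} → F) ℂ :=
  fun x y => ∑ z : {i // i ∉ A} → F,
    σ ((Equiv.piEquivPiSubtypeProd (fun i => i ∈ A) (fun _ => F)).symm (x, z))
      ((Equiv.piEquivPiSubtypeProd (fun i => i ∈ A) (fun _ => F)).symm (y, z))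

/-- The secret, a state of the register with basis `F^κ` that is encoded by the linear map `V` into
the register of qudits labelled by `ι`, can be recovered from the qudits in `A`: some quantum
channel acting on those qudits alone restores every secret state. -/
def SecretRecoverable {F κ ι : Type*} [Fintype F] [DecidableEq F] [Fintype κ] [DecidableEq κ]
    [Fintype ι] [DecidableEq ι] (V : Matrix (ι → F) (κ → F) ℂ) (A : Finset ι) : Prop :=
  ∃ R : Matrix ({i // i ∈ A} → F) ({i // i ∈ A} → F) ℂ → Matrix (κ → F) (κ → F) ℂ,
    IsQuantumChannel R ∧
      ∀ ρ : Matrix (κ → F) (κ → F) ℂ, IsDensityMatrix ρ →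
        R (reducedState A (V * ρ * Vᴴ)) = ρ

/-! ### CSS codes and extended CSS codes -/

/-- The standard basis vector `|y⟩`. -/
def ket {α : Type*} [DecidableEq α] (y : α) : α → ℂ := Pi.single y 1

/-- The encoder of the CSS code with `G_{C₀/C₁} = GQ` and `G_{C₁} = G₁`; its column indexed by
`s` is the state `|C₁|^{-1/2} ∑ᵣ |GQᵀ s + G₁ᵀ r⟩`. -/
noncomputable def cssEncoder {F κ μ ι : Type*} [Field F] [Fintype F] [DecidableEq F]
    [Fintype κ] [Fintype μ] [DecidableEq μ] [Fintype ι] [DecidableEq ι]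
    (GQ : Matrix κ ι F) (G₁ : Matrix μ ι F) : Matrix (ι → F) (κ → F) ℂ :=
  fun x s => ((1 / Real.sqrt (Fintype.card (μ → F)) : ℝ) : ℂ) *
    ∑ r : μ → F, ket (GQᵀ *ᵥ s + G₁ᵀ *ᵥ r) x

/-- The encoder of the extended CSS code `ECSS(F₀, F₁, GE)`, where `GQ = G_{F₀/F₁}` and
`G₁ = G_{F₁}`: it is the CSS code with `G_{C₀/C₁} = [GQ 0]` and `G_{C₁} = [G₁ 0; GE I]`.
The label `Sum.inl j` stands for the `j`-th original qudit, and `Sum.inr j` for the `j`-th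
extension qudit. -/
noncomputable def ecssEncoder {F : Type*} [Field F] [Fintype F] [DecidableEq F]
    {m k n e : ℕ} (GQ : Matrix (Fin m) (Fin n) F) (G₁ : Matrix (Fin k) (Fin n) F)
    (GE : Matrix (Fin e) (Fin n) F) :
    Matrix (Fin n ⊕ Fin e → F) (Fin m → F) ℂ :=
  cssEncoder (Matrix.fromCols GQ (0 : Matrix (Fin m) (Fin e) F))
    (Matrix.fromBlocks G₁ (0 : Matrix (Fin k) (Fin e) F) GE (1 : Matrix (Fin e) (Fin e) F))

/-! Each secret basis state becomes a uniform superposition over a coset, so recovery from `A`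
reduces to two linear conditions (`secretRecoverable_cssEncoder_iff`). A word vanishing on `A` must
encode `0`; otherwise two basis secrets look alike on `A`. Every secret must be encoded by some word
supported in `A`; otherwise the complement of `A` learns about the secret and coherence is lost.
Conversely, the two conditions give explicit Kraus operators.

For `J` plus all extension qudits, the first condition forces `r₂ = 0` and concerns only `F₀ ∖ F₁`.
The second leaves `r₂` free: `F₀ + E` and `F₁ + E` must agree outside `J`, which dualizes to a
statement about vectors vanishing on `J`. Counting zeros of a minimum-weight vector turns both into
the bound on `τ`. -/

/-! ### Partial traces -/

/-- The vector with coordinates `x` on `A` and `z` outside `A`. -/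
def glue {F ι : Type*} [DecidableEq ι] (A : Finset ι) (x : {i // i ∈ A} → F)
    (z : {i // i ∉ A} → F) : ι → F :=
  (Equiv.piEquivPiSubtypeProd (fun i => i ∈ A) (fun _ => F)).symm (x, z)

theorem glue_apply_mem {F ι : Type*} [DecidableEq ι] (A : Finset ι) (x : {i // i ∈ A} → F)
    (z : {i // i ∉ A} → F) {i : ι} (hi : i ∈ A) : glue A x z i = x ⟨i, hi⟩ := by
  simp [glue, Equiv.piEquivPiSubtypeProd, hi]

theorem glue_apply_not_mem {F ι : Type*} [DecidableEq ι] (A : Finset ι) (x : {i // i ∈ A} → F)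
    (z : {i // i ∉ A} → F) {i : ι} (hi : i ∉ A) : glue A x z i = z ⟨i, hi⟩ := by
  simp [glue, Equiv.piEquivPiSubtypeProd, hi]

theorem sum_glue {F ι M : Type*} [Fintype F] [Fintype ι] [DecidableEq ι] [AddCommMonoid M]
    (A : Finset ι) (f : (ι → F) → M) :
    ∑ x : {i // i ∈ A} → F, ∑ z : {i // i ∉ A} → F, f (glue A x z) = ∑ w, f w := by
  rw [← Fintype.sum_prod_type']
  exact Equiv.sum_comp (Equiv.piEquivPiSubtypeProd (fun i => i ∈ A) (fun _ => F)).symm f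

/-- The block of rows of `V` whose index has coordinates `z` outside `A`. -/
def rowBlock {F ι α : Type*} [DecidableEq ι] (A : Finset ι) (V : Matrix (ι → F) α ℂ)
    (z : {i // i ∉ A} → F) : Matrix ({i // i ∈ A} → F) α ℂ :=
  fun x s => V (glue A x z) s

theorem reducedState_conj {F ι α : Type*} [Fintype F] [Fintype ι] [DecidableEq ι] [Fintype α]
    (A : Finset ι) (V : Matrix (ι → F) α ℂ) (ρ : Matrix α α ℂ) :
    reducedState A (V * ρ * Vᴴ) = ∑ z, rowBlock A V z * ρ * (rowBlock A V z)ᴴ := by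
  ext x y
  rw [Matrix.sum_apply]
  rfl

/-- The partial trace of `V |s⟩⟨t| Vᴴ`, entrywise. -/
def reducedUnit {F ι α : Type*} [Fintype F] [Fintype ι] [DecidableEq ι]
    (A : Finset ι) (V : Matrix (ι → F) α ℂ) (s t : α) (x y : {i // i ∈ A} → F) : ℂ :=
  ∑ z, V (glue A x z) s * star (V (glue A y z) t)

theorem reducedState_conj_apply {F ι α : Type*} [Fintype F] [Fintype ι] [DecidableEq ι]
    [Fintype α] (A : Finset ι) (V : Matrix (ι → F) α ℂ) (ρ : Matrix α α ℂ)
    (x y : {i // i ∈ A} → F) :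
    reducedState A (V * ρ * Vᴴ) x y = ∑ s, ∑ t, ρ s t * reducedUnit A V s t x y := by
  simp only [reducedState_conj, Matrix.sum_apply, Matrix.mul_apply, Finset.sum_mul,
    conjTranspose_apply, rowBlock, reducedUnit, Finset.mul_sum]
  simp only [Finset.sum_comm (s := (Finset.univ : Finset ({i // i ∉ A} → F)))]
  rw [Finset.sum_comm]
  refine Finset.sum_congr rfl fun s _ => Finset.sum_congr rfl fun t _ =>
    Finset.sum_congr rfl fun z _ => by ring

/-- The projection onto a normalized vector is a density matrix. -/
theorem isDensityMatrix_vecMulVec {α : Type*} [Fintype α] (v : α → ℂ) (hv : v ⬝ᵥ star v = 1) :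
    IsDensityMatrix (vecMulVec v (star v)) :=
  ⟨posSemidef_vecMulVec_self_star v, by rw [trace_vecMulVec, hv]⟩

theorem IsDensityMatrix.diagonal {α : Type*} [Fintype α] [DecidableEq α] {ρ : Matrix α α ℂ}
    (h : IsDensityMatrix ρ) : IsDensityMatrix (Matrix.diagonal fun s => ρ s s) :=
  ⟨PosSemidef.diagonal fun _ => h.1.diag_nonneg, by rw [trace_diagonal]; exact h.2⟩

theorem ket_apply {α : Type*} [DecidableEq α] (x y : α) :
    ket y x = if x = y then 1 else 0 := Pi.single_apply y 1 x

theorem ket_dotProduct_star {α : Type*} [Fintype α] [DecidableEq α] (y : α) :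
    ket y ⬝ᵥ star (ket y) = 1 := by
  simp [dotProduct, ket_apply]

/-- Two distinct states with the same reduced state cannot both be recovered. -/
theorem SecretRecoverable.injOn {F κ ι : Type*} [Fintype F] [DecidableEq F] [Fintype κ]
    [DecidableEq κ] [Fintype ι] [DecidableEq ι] {V : Matrix (ι → F) (κ → F) ℂ} {A : Finset ι}
    (h : SecretRecoverable V A) {ρ σ : Matrix (κ → F) (κ → F) ℂ} (hρ : IsDensityMatrix ρ)
    (hσ : IsDensityMatrix σ)
    (heq : reducedState A (V * ρ * Vᴴ) = reducedState A (V * σ * Vᴴ)) : ρ = σ := by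
  obtain ⟨R, -, hR⟩ := h
  rw [← hR ρ hρ, heq, hR σ hσ]

/-! ### Recoverability for CSS codes -/

section CSS

variable {F κ μ ι : Type*} [Field F] [Fintype F] [DecidableEq F] [Fintype κ]
  [Fintype μ] [DecidableEq μ] [Fintype ι] [DecidableEq ι]
  (GQ : Matrix κ ι F) (G₁ : Matrix μ ι F)

theorem exists_of_cssEncoder_ne_zero {x : ι → F} {s : κ → F} (h : cssEncoder GQ G₁ x s ≠ 0) :
    ∃ r, x = GQᵀ *ᵥ s + G₁ᵀ *ᵥ r := by
  by_contra! hx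
  exact h (by simp [cssEncoder, ket_apply, hx])

/-- Reindexing the sum over `r` absorbs the shift. This covariance serves both directions of the
criterion. -/
theorem cssEncoder_add (x : ι → F) (s t : κ → F) (r : μ → F) :
    cssEncoder GQ G₁ (x + (GQᵀ *ᵥ t + G₁ᵀ *ᵥ r)) (s + t) = cssEncoder GQ G₁ x s := by
  unfold cssEncoder
  congr 1
  refine (Fintype.sum_equiv (Equiv.addRight r) _ _ fun r' => ?_).symm
  have : GQᵀ *ᵥ (s + t) + G₁ᵀ *ᵥ (r' + r)
      = (GQᵀ *ᵥ s + G₁ᵀ *ᵥ r') + (GQᵀ *ᵥ t + G₁ᵀ *ᵥ r) := by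
    rw [mulVec_add, mulVec_add]; abel
  simp only [ket_apply, Equiv.coe_addRight, this, add_left_inj]

theorem sum_cssEncoder_mul_star (hinj : Function.Injective (G₁ᵀ *ᵥ ·)) (s : κ → F) :
    ∑ x, cssEncoder GQ G₁ x s * star (cssEncoder GQ G₁ x s) = 1 := by
  have key : ∀ x : ι → F, cssEncoder GQ G₁ x s * star (cssEncoder GQ G₁ x s)
      = (1 / Fintype.card (μ → F) : ℂ) *
        ∑ r : μ → F, if x = GQᵀ *ᵥ s + G₁ᵀ *ᵥ r then 1 else 0 := by
    intro x
    have hsq : (((1 / Real.sqrt (Fintype.card (μ → F)) : ℝ) : ℂ)) *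
        ((1 / Real.sqrt (Fintype.card (μ → F)) : ℝ) : ℂ) = 1 / Fintype.card (μ → F) := by
      rw [← Complex.ofReal_mul, div_mul_div_comm, Real.mul_self_sqrt (by positivity)]
      simp
    by_cases hx : ∃ r, x = GQᵀ *ᵥ s + G₁ᵀ *ᵥ r
    · obtain ⟨r₀, rfl⟩ := hx
      have h1 : ∀ r, GQᵀ *ᵥ s + G₁ᵀ *ᵥ r₀ = GQᵀ *ᵥ s + G₁ᵀ *ᵥ r ↔ r₀ = r :=
        fun r => by rw [add_right_inj]; exact hinj.eq_iff
      simp only [cssEncoder, ket_apply, h1, Finset.sum_ite_eq, Finset.mem_univ, if_true, mul_one,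
        ← hsq, Complex.star_def, Complex.conj_ofReal]
    · push Not at hx
      simp [cssEncoder, ket_apply, hx]
  simp only [key, ← Finset.mul_sum]
  rw [Finset.sum_comm]
  simp

variable [DecidableEq κ]

/-- Translation by `w` carries the encoding of `|0⟩` to that of `|s⟩`. As `w` vanishes on `A`, it
only permutes the traced-out basis, so both reduced states coincide. -/
theorem eq_zero_of_secretRecoverable_cssEncoder {A : Finset ι}
    (h : SecretRecoverable (cssEncoder GQ G₁) A) {s : κ → F} {r : μ → F}
    (hs : ∀ i ∈ A, (GQᵀ *ᵥ s + G₁ᵀ *ᵥ r) i = 0) : s = 0 := by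
  set w := GQᵀ *ᵥ s + G₁ᵀ *ᵥ r with hw
  have key := h.injOn (isDensityMatrix_vecMulVec (ket s) (ket_dotProduct_star s))
    (isDensityMatrix_vecMulVec (ket 0) (ket_dotProduct_star 0)) ?_
  · by_contra hne
    have := congrFun (congrFun key 0) 0
    simp [vecMulVec_apply, ket_apply, Ne.symm hne] at this
  · ext x y
    simp only [reducedState_conj_apply, vecMulVec_apply, ket_apply, Pi.star_apply, ite_mul, mul_ite,
      apply_ite star, star_one, star_zero, one_mul, mul_one, zero_mul, mul_zero,
      Finset.sum_ite_eq', Finset.mem_univ, if_true]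
    refine (Fintype.sum_equiv (Equiv.addRight fun i : {i // i ∉ A} => w i) _ _ fun z => ?_).symm
    have hg : ∀ x : {i // i ∈ A} → F,
        glue A x (z + fun i : {i // i ∉ A} => w i) = glue A x z + w := by
      intro x
      ext i
      by_cases hi : i ∈ A
      · simp [glue_apply_mem A _ _ hi, hs i hi]
      · simp [glue_apply_not_mem A _ _ hi]
    have hv : ∀ x, cssEncoder GQ G₁ (x + w) s = cssEncoder GQ G₁ x 0 := fun x => by
      simpa using cssEncoder_add GQ G₁ x 0 s r
    simp only [Equiv.coe_addRight, hg, hv]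

/-- If every word encoding `s` is nonzero somewhere outside `A`, words of secrets differing by `±s`
never agree there, and their cross terms vanish in the partial trace. Then `(|0⟩ + |s⟩)/√2` and its
dephased version have the same reduced state. -/
theorem exists_forall_not_mem_of_secretRecoverable_cssEncoder {A : Finset ι}
    (h : SecretRecoverable (cssEncoder GQ G₁) A) (s : κ → F) :
    ∃ r, ∀ i ∉ A, (GQᵀ *ᵥ s + G₁ᵀ *ᵥ r) i = 0 := by
  by_contra! hs
  have hs0 : s ≠ 0 := by
    rintro rfl
    obtain ⟨i, -, hi⟩ := hs 0
    simp at hi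
  have hunit : ∀ t u, (t - u = s ∨ u - t = s) → ∀ x y,
      reducedUnit A (cssEncoder GQ G₁) t u x y = 0 := by
    intro t u htu x y
    refine Finset.sum_eq_zero fun z _ => ?_
    by_contra hne
    obtain ⟨r, hr⟩ := exists_of_cssEncoder_ne_zero GQ G₁ (left_ne_zero_of_mul hne)
    obtain ⟨r', hr'⟩ := exists_of_cssEncoder_ne_zero GQ G₁
      (star_ne_zero.1 (right_ne_zero_of_mul hne))
    have hz : ∀ i ∉ A, (GQᵀ *ᵥ t + G₁ᵀ *ᵥ r) i = (GQᵀ *ᵥ u + G₁ᵀ *ᵥ r') i := fun i hi => by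
      rw [← hr, ← hr', glue_apply_not_mem A _ _ hi, glue_apply_not_mem A _ _ hi]
    rcases htu with rfl | rfl
    · obtain ⟨i, hi, hi'⟩ := hs (r - r')
      have := hz i hi
      simp only [mulVec_sub, Pi.add_apply, Pi.sub_apply] at this hi'
      exact hi' (by linear_combination this)
    · obtain ⟨i, hi, hi'⟩ := hs (r' - r)
      have := hz i hi
      simp only [mulVec_sub, Pi.add_apply, Pi.sub_apply] at this hi'
      exact hi' (by linear_combination -this)
  set a : ℂ := ((1 / Real.sqrt 2 : ℝ) : ℂ) with ha
  have haa : a * a = 1 / 2 := by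
    rw [ha, ← Complex.ofReal_mul, div_mul_div_comm, Real.mul_self_sqrt (by norm_num)]
    simp
  have hstar : star a = a := Complex.conj_ofReal _
  set v : (κ → F) → ℂ := fun t => a * (ket 0 t + ket s t) with hvdef
  have hvv : v ⬝ᵥ star v = 1 := by
    have : ∀ t, v t * star (v t) = a * a * (ket 0 t + ket s t) := by
      intro t
      simp only [hvdef, ket_apply, star_mul', hstar]
      by_cases h0 : t = 0
      · simp [h0, hs0.symm]
      · by_cases h1 : t = s <;> simp [h0, h1, hs0]
    simp only [dotProduct, Pi.star_apply, this, ← Finset.mul_sum, Finset.sum_add_distrib, haa]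
    simp [ket_apply]
    norm_num
  have hρ := isDensityMatrix_vecMulVec v hvv
  have key := h.injOn hρ hρ.diagonal ?_
  · have h0 := congrFun (congrFun key 0) s
    have ha0 : a ≠ 0 := by
      rintro h0
      rw [h0] at haa
      norm_num at haa
    simp [vecMulVec_apply, hvdef, ket_apply, hs0, hs0.symm, ha0] at h0
  · ext x y
    simp only [reducedState_conj_apply]
    refine Finset.sum_congr rfl fun t _ => Finset.sum_congr rfl fun u _ => ?_
    by_cases htu : t = u
    · subst htu
      rw [diagonal_apply_eq]
    · rw [diagonal_apply_ne _ htu, zero_mul]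
      -- The only off-diagonal entries of the state are at `(0, s)` and `(s, 0)`.
      by_cases hcase : t - u = s ∨ u - t = s
      · rw [hunit t u hcase, mul_zero]
      · have : v t * star (v u) = 0 := by
          simp only [hvdef, ket_apply]
          by_cases t0 : t = 0 <;> by_cases t1 : t = s <;> by_cases u0 : u = 0 <;>
            by_cases u1 : u = s <;> simp_all
        rw [vecMulVec_apply, Pi.star_apply, this, zero_mul]

/-- The decoder reads `D a`, undoes the shift `g (D a)` and discards what remains. Its Kraus
operators `K b` act on each block of the encoder as scalars, whose squared moduli sum to the norm of
the encoded `|0⟩`. -/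
theorem secretRecoverable_cssEncoder {A : Finset ι} (hinj : Function.Injective (G₁ᵀ *ᵥ ·))
    (hA : ∀ s r, (∀ i ∈ A, (GQᵀ *ᵥ s + G₁ᵀ *ᵥ r) i = 0) → s = 0)
    (hB : ∀ s, ∃ r, ∀ i ∉ A, (GQᵀ *ᵥ s + G₁ᵀ *ᵥ r) i = 0) :
    SecretRecoverable (cssEncoder GQ G₁) A := by
  choose L hL using hB
  set g : (κ → F) → {i // i ∈ A} → F := fun s i => (GQᵀ *ᵥ s + G₁ᵀ *ᵥ L s) i with hg
  have hglue : ∀ s b z, glue A (b + g s) z = glue A b z + (GQᵀ *ᵥ s + G₁ᵀ *ᵥ L s) := by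
    intro s b z
    ext i
    by_cases hi : i ∈ A
    · simp [glue_apply_mem A _ _ hi, hg]
    · simp only [Pi.add_apply (glue A b z), glue_apply_not_mem A _ _ hi, hL s i hi, add_zero]
  -- decoding in the standard basis
  obtain ⟨D, hD⟩ : ∃ D : ({i // i ∈ A} → F) → κ → F,
      ∀ s r, D (fun i => (GQᵀ *ᵥ s + G₁ᵀ *ᵥ r) i) = s := by
    have hfac : Function.FactorsThrough (fun p : (κ → F) × (μ → F) => p.1)
        (fun (p : (κ → F) × (μ → F)) (i : {i // i ∈ A}) => (GQᵀ *ᵥ p.1 + G₁ᵀ *ᵥ p.2) i) := by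
      intro p p' h
      refine sub_eq_zero.1 (hA (p.1 - p'.1) (p.2 - p'.2) fun i hi => ?_)
      have := congrFun h ⟨i, hi⟩
      simp only [mulVec_sub, Pi.add_apply, Pi.sub_apply] at this ⊢
      linear_combination this
    exact ⟨Function.extend _ (fun p : (κ → F) × (μ → F) => p.1) 0, fun s r => hfac.extend_apply 0 (s, r)⟩
  let K : ({i // i ∈ A} → F) → Matrix (κ → F) ({i // i ∈ A} → F) ℂ :=
    fun b s a => if a = b + g s ∧ D a = s then 1 else 0
  have hK : ∀ b s a, K b s a = if a = b + g s ∧ D a = s then 1 else 0 := fun _ _ _ => rfl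
  let β : ({i // i ∈ A} → F) → ({i // i ∉ A} → F) → ℂ :=
    fun b z => cssEncoder GQ G₁ (glue A b z) 0
  have hKW : ∀ b z, K b * rowBlock A (cssEncoder GQ G₁) z = β b z • 1 := by
    intro b z
    ext s' s
    have hDs : ∀ a, cssEncoder GQ G₁ (glue A a z) s ≠ 0 → D a = s := by
      intro a ha
      obtain ⟨r, hr⟩ := exists_of_cssEncoder_ne_zero GQ G₁ ha
      rw [← hD s r]
      congr 1
      ext i
      rw [← hr, glue_apply_mem A _ _ i.2]
    have hval : cssEncoder GQ G₁ (glue A (b + g s) z) s = β b z := by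
      rw [hglue]
      simpa using cssEncoder_add GQ G₁ (glue A b z) 0 s (L s)
    simp only [mul_apply, hK, rowBlock, ite_and, ite_mul, one_mul, zero_mul, Finset.sum_ite_eq',
      Finset.mem_univ, if_true, Matrix.smul_apply, one_apply, smul_eq_mul, mul_ite, mul_one, mul_zero]
    by_cases hs : s' = s
    · subst hs
      rw [if_pos rfl, hval, ite_eq_left_iff]
      intro hne
      by_contra h
      exact hne (hDs _ (by rw [hval]; exact Ne.symm h))
    · rw [if_neg hs, ite_eq_right_iff]
      intro hd
      by_contra h
      exact hs (hd.symm.trans (hDs _ h))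
  have hKK : ∑ b, (K b)ᴴ * K b = 1 := by
    ext a a'
    simp only [Matrix.sum_apply, mul_apply, conjTranspose_apply, hK, apply_ite star, star_one,
      star_zero, ite_mul, one_mul, zero_mul]
    -- The map `a ↦ (a - g (D a), D a)` is injective, so exactly one pair `(b, s)` contributes to
    -- each `a`.
    rw [Finset.sum_eq_single (a - g (D a)), Finset.sum_eq_single (D a)]
    · by_cases h : a = a'
      · subst h
        simp
      · have : ¬ (a' = a ∧ D a' = D a) := fun h' => h h'.1.symm
        simp [h, this]
    · intro s _ hs
      rw [if_neg fun h => hs h.2.symm]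
    · simp
    · intro b _ hb
      refine Finset.sum_eq_zero fun s _ => if_neg ?_
      rintro ⟨h1, h2⟩
      exact hb (by rw [h2]; exact eq_sub_of_add_eq h1.symm)
    · simp
  refine ⟨fun ρ => ∑ b, K b * ρ * (K b)ᴴ, ?_, fun ρ _ => ?_⟩
  · let e := Fintype.equivFin ({i // i ∈ A} → F)
    refine ⟨_, fun j => K (e.symm j), ?_, fun ρ => ?_⟩
    · rw [Equiv.sum_comp e.symm fun b => (K b)ᴴ * K b, hKK]
    · exact (Equiv.sum_comp e.symm fun b => K b * ρ * (K b)ᴴ).symm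
  · have hterm : ∀ b z, K b * (rowBlock A (cssEncoder GQ G₁) z * ρ *
        (rowBlock A (cssEncoder GQ G₁) z)ᴴ) * (K b)ᴴ = (β b z * star (β b z)) • ρ := by
      intro b z
      calc _ = (K b * rowBlock A (cssEncoder GQ G₁) z) * ρ *
            (K b * rowBlock A (cssEncoder GQ G₁) z)ᴴ := by
            rw [conjTranspose_mul]; simp only [Matrix.mul_assoc]
        _ = _ := by
            rw [hKW, conjTranspose_smul, conjTranspose_one, smul_mul, Matrix.one_mul, Matrix.mul_smul,
              Matrix.mul_one, smul_smul, mul_comm]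
    simp only [reducedState_conj, Matrix.mul_sum, Matrix.sum_mul, hterm, ← Finset.sum_smul, β]
    rw [sum_glue A fun x => cssEncoder GQ G₁ x 0 * star (cssEncoder GQ G₁ x 0),
      sum_cssEncoder_mul_star GQ G₁ hinj, one_smul]

/-- The qudits in `A` recover the secret of a CSS code if and only if the secret is determined in
the standard basis by the coordinates in `A`, and the coordinates outside `A` carry no
information on it. -/
theorem secretRecoverable_cssEncoder_iff {A : Finset ι}
    (hinj : Function.Injective (G₁ᵀ *ᵥ ·)) :
    SecretRecoverable (cssEncoder GQ G₁) A ↔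
      (∀ s r, (∀ i ∈ A, (GQᵀ *ᵥ s + G₁ᵀ *ᵥ r) i = 0) → s = 0) ∧
      ∀ s, ∃ r, ∀ i ∉ A, (GQᵀ *ᵥ s + G₁ᵀ *ᵥ r) i = 0 :=
  ⟨fun h => ⟨fun _ _ => eq_zero_of_secretRecoverable_cssEncoder GQ G₁ h,
    exists_forall_not_mem_of_secretRecoverable_cssEncoder GQ G₁ h⟩,
    fun h => secretRecoverable_cssEncoder GQ G₁ hinj h.1 h.2⟩

end CSS

/-! ### Codes -/

theorem mem_rowSpace_iff {F κ ι : Type*} [Field F] [Fintype κ] {G : Matrix κ ι F} {x : ι → F} :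
    x ∈ rowSpace G ↔ ∃ s, Gᵀ *ᵥ s = x := by
  have : rowSpace G = LinearMap.range Gᵀ.mulVecLin := by
    rw [range_mulVecLin, col_transpose]; rfl
  rw [this]
  rfl

theorem IsGeneratorMatrix.injective {F κ ι : Type*} [Field F] [Fintype κ] {G : Matrix κ ι F}
    {C : Submodule F (ι → F)} (h : IsGeneratorMatrix G C) :
    Function.Injective (Gᵀ *ᵥ ·) := by
  refine mulVec_injective_iff.2 ?_
  rw [col_transpose]
  exact h.1

theorem IsGeneratorMatrix.mem_iff {F κ ι : Type*} [Field F] [Fintype κ] {G : Matrix κ ι F}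
    {C : Submodule F (ι → F)} (h : IsGeneratorMatrix G C) {x : ι → F} :
    x ∈ C ↔ ∃ s, Gᵀ *ᵥ s = x := by
  rw [← h.2, mem_rowSpace_iff]

theorem IsQuotientGeneratorMatrix.mem_iff {F κ ι : Type*} [Field F] [Fintype κ]
    {G : Matrix κ ι F} {C₀ C₁ : Submodule F (ι → F)} (h : IsQuotientGeneratorMatrix G C₀ C₁)
    {x : ι → F} : x ∈ C₀ ↔ ∃ s, ∃ c ∈ C₁, Gᵀ *ᵥ s + c = x := by
  obtain ⟨D, -, rfl, hD⟩ := h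
  rw [Submodule.mem_sup]
  constructor
  · rintro ⟨d, hd, c, hc, rfl⟩
    obtain ⟨s, rfl⟩ := hD.mem_iff.1 hd
    exact ⟨s, c, hc, rfl⟩
  · rintro ⟨s, c, hc, rfl⟩
    exact ⟨_, hD.mem_iff.2 ⟨s, rfl⟩, c, hc, rfl⟩

theorem IsQuotientGeneratorMatrix.eq_zero {F κ ι : Type*} [Field F] [Fintype κ]
    {G : Matrix κ ι F} {C₀ C₁ : Submodule F (ι → F)} (h : IsQuotientGeneratorMatrix G C₀ C₁)
    {s : κ → F} (hs : Gᵀ *ᵥ s ∈ C₁) : s = 0 := by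
  obtain ⟨D, hbot, -, hD⟩ := h
  have hmem : Gᵀ *ᵥ s ∈ D ⊓ C₁ := ⟨hD.mem_iff.2 ⟨s, rfl⟩, hs⟩
  rw [hbot, Submodule.mem_bot] at hmem
  exact hD.injective (hmem.trans (mulVec_zero _).symm)

theorem codeDiff_nonempty {F ι : Type*} [Field F] {C₀ C₁ : Submodule F (ι → F)} (h : C₁ < C₀) :
    (codeDiff C₀ C₁).Nonempty := by
  obtain ⟨x, hx, hx'⟩ := SetLike.exists_of_lt h
  exact ⟨x, hx, hx'⟩

theorem mem_dualCode_sup {F ι : Type*} [Field F] [Fintype ι] {C D : Submodule F (ι → F)}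
    {x : ι → F} : x ∈ dualCode (C ⊔ D) ↔ (∀ c ∈ C, c ⬝ᵥ x = 0) ∧ ∀ d ∈ D, d ⬝ᵥ x = 0 := by
  constructor
  · exact fun h => ⟨fun c hc => h c (Submodule.mem_sup_left hc),
      fun d hd => h d (Submodule.mem_sup_right hd)⟩
  · rintro ⟨hC, hD⟩ y hy
    obtain ⟨c, hc, d, hd, rfl⟩ := Submodule.mem_sup.1 hy
    rw [add_dotProduct, hC c hc, hD d hd, add_zero]

/-- A vector outside a code is detected by a dual vector. -/
theorem exists_mem_dualCode_dotProduct_ne_zero {F ι : Type*} [Field F] [Fintype ι]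
    [DecidableEq ι] {C : Submodule F (ι → F)} {y : ι → F} (hy : y ∉ C) :
    ∃ x ∈ dualCode C, y ⬝ᵥ x ≠ 0 := by
  obtain ⟨f, hf, hf'⟩ := Submodule.exists_dual_map_eq_bot_of_notMem hy inferInstance
  have hfx : ∀ c, c ⬝ᵥ (fun i => f (Pi.single i 1)) = f c := by
    intro c
    conv_rhs => rw [pi_eq_sum_univ' c]
    simp [dotProduct, map_sum]
  refine ⟨fun i => f (Pi.single i 1), fun c hc => ?_, by rwa [hfx]⟩
  rw [hfx, ← Submodule.mem_bot F, ← hf']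
  exact Submodule.mem_map_of_mem hc

/-- `C₀` and `C₁` agree outside `J` if and only if no vector of the difference of the dual codes
vanishes on `J`. -/
theorem forall_codeDiff_dualCode_iff {F ι : Type*} [Field F] [Fintype ι] [DecidableEq ι]
    {C₀ C₁ : Submodule F (ι → F)} (J : Finset ι) :
    (∀ x ∈ codeDiff (dualCode C₁) (dualCode C₀), ¬ ∀ i ∈ J, x i = 0) ↔
      ∀ c ∈ C₀, ∃ d ∈ C₁, ∀ i ∉ J, c i = d i := by
  constructor
  · intro h c hc
    by_contra! hne
    -- A dual vector of `C₁ ⊔ S` vanishes on `J`, since `S` contains the unit vectors at points of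
    -- `J`.
    let S : Submodule F (ι → F) :=
      { carrier := {v | ∀ i ∉ J, v i = 0}
        add_mem' := fun ha hb i hi => by simp [ha i hi, hb i hi]
        zero_mem' := fun _ _ => rfl
        smul_mem' := fun a v hv i hi => by simp [hv i hi] }
    have hcS : c ∉ C₁ ⊔ S := by
      intro hmem
      obtain ⟨d, hd, v, hv, rfl⟩ := Submodule.mem_sup.1 hmem
      obtain ⟨i, hi, hi'⟩ := hne d hd
      exact hi' (by simp [hv i hi])
    obtain ⟨x, hx, hcx⟩ := exists_mem_dualCode_dotProduct_ne_zero hcS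
    rw [mem_dualCode_sup] at hx
    refine h x ⟨hx.1, fun h0 => hcx (h0 c hc)⟩ fun j hj => ?_
    have := hx.2 (Pi.single j 1) fun i hi =>
      Pi.single_eq_of_ne (fun hij => hi (by rwa [hij])) 1
    simpa using this
  · rintro h x ⟨hx1, hx0⟩ hxJ
    refine hx0 fun c hc => ?_
    obtain ⟨d, hd, hcd⟩ := h c hc
    rw [← hx1 d hd]
    refine Finset.sum_congr rfl fun i _ => ?_
    by_cases hi : i ∈ J
    · rw [hxJ i hi, mul_zero, mul_zero]
    · rw [hcd i hi]

/-- A vector vanishes on some `τ`-set exactly when it has at least `τ` zeros, and a minimum-weight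
vector has the most zeros. -/
theorem forall_card_eq_iff_lt_add_minWeight {F ι : Type*} [Field F] [DecidableEq F] [Fintype ι]
    {S : Set (ι → F)} (hS : S.Nonempty) (τ : ℕ) :
    (∀ J : Finset ι, J.card = τ → ∀ x ∈ S, ¬ ∀ i ∈ J, x i = 0) ↔
      Fintype.card ι < τ + minWeight S := by
  classical
  have hcard : ∀ x : ι → F,
      (Finset.univ.filter fun i => x i = 0).card + hammingNorm x = Fintype.card ι := fun x =>
    Finset.card_filter_add_card_filter_not (s := Finset.univ) fun i => x i = 0
  constructor
  · intro h
    obtain ⟨x, hx, hxw⟩ := Nat.sInf_mem (hS.image hammingNorm)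
    by_contra! hlt
    have h1 : hammingNorm x = minWeight S := hxw
    have h2 := hcard x
    obtain ⟨J, hJ, hJτ⟩ := Finset.exists_subset_card_eq
      (show τ ≤ (Finset.univ.filter fun i => x i = 0).card by omega)
    exact h J hJτ x hx fun i hi => (Finset.mem_filter.1 (hJ hi)).2
  · rintro h J rfl x hx hxJ
    have h1 : minWeight S ≤ hammingNorm x := Nat.sInf_le ⟨x, hx, rfl⟩
    have h2 := Finset.card_le_card (show J ⊆ Finset.univ.filter fun i => x i = 0 from
      fun i hi => Finset.mem_filter.2 ⟨Finset.mem_univ i, hxJ i hi⟩)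
    have h3 := hcard x
    omega

theorem dualCode_lt_of_lt {F ι : Type*} [Field F] [Fintype ι] [DecidableEq ι]
    {C₀ C₁ : Submodule F (ι → F)} (h : C₁ < C₀) : dualCode C₀ < dualCode C₁ := by
  refine SetLike.lt_iff_le_and_exists.2 ⟨fun x hx c hc => hx c (h.le hc), ?_⟩
  obtain ⟨y, hy0, hy1⟩ := SetLike.exists_of_lt h
  obtain ⟨x, hx, hxy⟩ := exists_mem_dualCode_dotProduct_ne_zero hy1
  exact ⟨x, hx, fun hx0 => hxy (hx0 y hy0)⟩

/-! ### Extended CSS codes -/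

section ECSS

variable {F : Type*} [Field F] {n e m k : ℕ} (GQ : Matrix (Fin m) (Fin n) F)
  (G₁ : Matrix (Fin k) (Fin n) F) (GE : Matrix (Fin e) (Fin n) F)

theorem fromCols_fromBlocks_mulVec_inl (s : Fin m → F) (r : Fin k ⊕ Fin e → F) (i : Fin n) :
    ((fromCols GQ (0 : Matrix (Fin m) (Fin e) F))ᵀ *ᵥ s +
      (fromBlocks G₁ (0 : Matrix (Fin k) (Fin e) F) GE (1 : Matrix (Fin e) (Fin e) F))ᵀ *ᵥ r)
        (Sum.inl i) =
      (GQᵀ *ᵥ s + (G₁ᵀ *ᵥ (r ∘ Sum.inl) + GEᵀ *ᵥ (r ∘ Sum.inr))) i := by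
  simp [transpose_fromCols, fromBlocks_transpose, fromBlocks_mulVec]

theorem fromCols_fromBlocks_mulVec_inr (s : Fin m → F) (r : Fin k ⊕ Fin e → F) (j : Fin e) :
    ((fromCols GQ (0 : Matrix (Fin m) (Fin e) F))ᵀ *ᵥ s +
      (fromBlocks G₁ (0 : Matrix (Fin k) (Fin e) F) GE (1 : Matrix (Fin e) (Fin e) F))ᵀ *ᵥ r)
        (Sum.inr j) = r (Sum.inr j) := by
  simp [transpose_fromCols, fromBlocks_transpose, fromBlocks_mulVec]

/-- The identity block exposes `r₂`, so `GE` need not have full rank. -/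
theorem injective_fromBlocks_one_mulVec (h : Function.Injective (G₁ᵀ *ᵥ ·)) :
    Function.Injective ((fromBlocks G₁ (0 : Matrix (Fin k) (Fin e) F) GE
      (1 : Matrix (Fin e) (Fin e) F))ᵀ *ᵥ ·) := by
  intro r r' hr
  simp only [fromBlocks_transpose, fromBlocks_mulVec, transpose_zero, zero_mulVec, zero_add,
    transpose_one, one_mulVec, Sum.elim_eq_iff] at hr
  obtain ⟨h1, h2⟩ := hr
  rw [h2, add_left_inj] at h1
  have h1 := h h1
  ext (i | j)
  · exact congrFun h1 i
  · exact congrFun h2 j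

/-- The secret of an extended CSS code is recovered from `J` and the extension qudits if and only
if no vector of `F₀ ∖ F₁` and of `(F₁ + E)^⊥ ∖ (F₀ + E)^⊥` vanishes on `J`. -/
theorem secretRecoverable_ecssEncoder_iff [Fintype F] [DecidableEq F]
    {F₀ F₁ : Submodule F (Fin n → F)} (hGQ : IsQuotientGeneratorMatrix GQ F₀ F₁)
    (hG₁ : IsGeneratorMatrix G₁ F₁) (J : Finset (Fin n)) :
    SecretRecoverable (ecssEncoder GQ G₁ GE) (J.disjSum (Finset.univ : Finset (Fin e))) ↔
      (∀ x ∈ codeDiff F₀ F₁, ¬ ∀ i ∈ J, x i = 0) ∧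
      ∀ x ∈ codeDiff (dualCode (F₁ ⊔ rowSpace GE)) (dualCode (F₀ ⊔ rowSpace GE)),
        ¬ ∀ i ∈ J, x i = 0 := by
  rw [forall_codeDiff_dualCode_iff, ecssEncoder, secretRecoverable_cssEncoder_iff _ _
    (injective_fromBlocks_one_mulVec G₁ GE hG₁.injective)]
  refine and_congr ?_ ?_
  · simp only [Sum.forall, Finset.inl_mem_disjSum, Finset.inr_mem_disjSum, Finset.mem_univ,
      true_imp_iff, fromCols_fromBlocks_mulVec_inl, fromCols_fromBlocks_mulVec_inr]
    constructor
    · rintro h x ⟨hx0, hx1⟩ hxJ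
      obtain ⟨s, c, hc, rfl⟩ := hGQ.mem_iff.1 hx0
      obtain ⟨r, rfl⟩ := hG₁.mem_iff.1 hc
      have hs := h s (Sum.elim r 0) ⟨fun i hi => by simpa using hxJ i hi, fun _ => rfl⟩
      rw [hs, mulVec_zero, zero_add] at hx1
      exact hx1 hc
    · rintro h s r ⟨hr, hr'⟩
      by_contra hs
      have hr0 : r ∘ Sum.inr = 0 := funext hr'
      have hmem : G₁ᵀ *ᵥ (r ∘ Sum.inl) ∈ F₁ := hG₁.mem_iff.2 ⟨_, rfl⟩
      refine h (GQᵀ *ᵥ s + G₁ᵀ *ᵥ (r ∘ Sum.inl)) ⟨hGQ.mem_iff.2 ⟨s, _, hmem, rfl⟩,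
        fun h1 => hs (hGQ.eq_zero ((Submodule.add_mem_iff_left _ hmem).1 h1))⟩ fun i hi => ?_
      simpa [hr0] using hr i hi
  · simp only [Sum.forall, Finset.inl_mem_disjSum, Finset.inr_mem_disjSum, Finset.mem_univ,
      not_true, false_imp_iff, implies_true, and_true, fromCols_fromBlocks_mulVec_inl]
    constructor
    · intro h c hc
      obtain ⟨a, ha, b, hb, rfl⟩ := Submodule.mem_sup.1 hc
      obtain ⟨s, a', ha', rfl⟩ := hGQ.mem_iff.1 ha
      obtain ⟨r, hr⟩ := h s
      have h1 : G₁ᵀ *ᵥ (r ∘ Sum.inl) ∈ F₁ := hG₁.mem_iff.2 ⟨_, rfl⟩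
      have h2 : GEᵀ *ᵥ (r ∘ Sum.inr) ∈ rowSpace GE := mem_rowSpace_iff.2 ⟨_, rfl⟩
      -- The witness is `c` minus the word encoding `s` that vanishes outside `J`; the `GQ` parts
      -- cancel.
      refine ⟨_, Submodule.add_mem_sup (sub_mem ha' h1) (sub_mem hb h2), fun i hi => ?_⟩
      have := hr i hi
      simp only [Pi.add_apply, Pi.sub_apply] at this ⊢
      linear_combination this
    · intro h s
      obtain ⟨d, hd, hsd⟩ := h (GQᵀ *ᵥ s) (Submodule.mem_sup_left
        (hGQ.mem_iff.2 ⟨s, 0, zero_mem _, add_zero _⟩))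
      obtain ⟨a, ha, b, hb, rfl⟩ := Submodule.mem_sup.1 hd
      obtain ⟨u, rfl⟩ := hG₁.mem_iff.1 ha
      obtain ⟨v, rfl⟩ := mem_rowSpace_iff.1 hb
      refine ⟨Sum.elim (-u) (-v), fun i hi => ?_⟩
      have := hsd i hi
      simp only [Sum.elim_comp_inl, Sum.elim_comp_inr, mulVec_neg, Pi.add_apply,
        Pi.neg_apply] at this ⊢
      linear_combination this

end ECSS

/-- Threshold of an extended CSS code with full access to the extension qudits. -/
theorem mainTheorem8 {F : Type*} [Field F] [Fintype F] [DecidableEq F] {n e m f₁ : ℕ}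
    (F₀ F₁ : Submodule F (Fin n → F))
    (GQ : Matrix (Fin m) (Fin n) F) (G₁ : Matrix (Fin f₁) (Fin n) F)
    (GE : Matrix (Fin e) (Fin n) F)
    (hGQ : IsQuotientGeneratorMatrix GQ F₀ F₁) (hG₁ : IsGeneratorMatrix G₁ F₁)
    (hN1 : F₁ < F₀) (hN2 : F₀ ⊓ rowSpace GE = ⊥) :
    (codeDiff F₀ F₁).Nonempty ∧
    (codeDiff (dualCode (F₁ ⊔ rowSpace GE)) (dualCode (F₀ ⊔ rowSpace GE))).Nonempty ∧
    ∀ τ : ℕ,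
      (∀ J : Finset (Fin n), J.card = τ →
        SecretRecoverable (ecssEncoder GQ G₁ GE) (J.disjSum (Finset.univ : Finset (Fin e)))) ↔
      (τ : ℤ) ≥ (n : ℤ) - (min (minWeight (codeDiff F₀ F₁))
        (minWeight (codeDiff (dualCode (F₁ ⊔ rowSpace GE)) (dualCode (F₀ ⊔ rowSpace GE)))) : ℕ)
        + 1 := by
  have hlt : F₁ ⊔ rowSpace GE < F₀ ⊔ rowSpace GE := by
    refine lt_of_le_of_ne (sup_le_sup_right hN1.le _) fun heq => hN1.ne ?_
    -- By modularity, nested subspaces with equal sum with `E` and comparable intersection with `E`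
    -- coincide.
    exact eq_of_le_of_inf_le_of_sup_le hN1.le (hN2.trans_le bot_le) heq.ge
  have hne₁ := codeDiff_nonempty hN1
  have hne₂ := codeDiff_nonempty (dualCode_lt_of_lt hlt)
  refine ⟨hne₁, hne₂, fun τ => ?_⟩
  simp only [secretRecoverable_ecssEncoder_iff GQ G₁ GE hGQ hG₁, imp_and, forall_and]
  rw [forall_card_eq_iff_lt_add_minWeight hne₁, forall_card_eq_iff_lt_add_minWeight hne₂,
    Fintype.card_fin]
  omega
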